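/- Let $G$ be a finite simple connected graph with $n \ge 3$ vertices, $m$ edges, maximum vertex degree $d_1$ and $t$ spanning trees. Let $\mu_1 \ge \mu_2 \ge \cdots \ge \mu_n$ be the eigenvalues (with multiplicity) of the Laplacian matrix of $G$, and let $LEE(G)=\sum_{i=1}^n e^{\mu_i}$ be the Laplacian Estrada index of $G$. Then $$LEE(G)\ \ge\ 1+e^{1+d_1}+(n-2)\,e^{\frac{2m-1-d_1}{n-2}}$$ and $$LEE(G)\ \ge\ 1+e^{1+d_1}+(n-2)\,e^{\left(\frac{tn}{1+d_1}\right)^{\frac{1}{n-2}}}.$$ In each of these two inequalities, equality holds if and only if $G$ is the complete graph $K_n$ or the star $S_n$ on $n$ vertices. -/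

import Mathlib

namespace SimpleGraph

/-- The Laplacian Estrada index `LEE(G) = ∑ exp μᵢ`, the sum being over all eigenvalues `μᵢ`
(with multiplicity) of the Laplacian matrix of `G`. -/
noncomputable def laplacianEstradaIndex {V : Type*} [Fintype V] [DecidableEq V]
    (G : SimpleGraph V) [DecidableRel G.Adj] : ℝ :=
  ∑ i, Real.exp ((isHermitian_lapMatrix ℝ G).eigenvalues i)

/-- The number of spanning trees of `G`: trees on the whole vertex set all of whose edges
are edges of `G`. -/
noncomputable def numSpanningTrees {V : Type*} (G : SimpleGraph V) : ℕ :=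
  Nat.card {T : SimpleGraph V // T ≤ G ∧ T.IsTree}

end SimpleGraph

/-! Write `D = 1 + d₁` and `N = n - 2`. Connectedness leaves one zero eigenvalue `μ_z`; a Rayleigh
quotient gives another, `μ_a ≥ D`. The other `N` eigenvalues sum to `2m - μ_a`. Let `c = (2m - D) /
N`; degree bounds give `c ≤ D`. Bounding `exp` below by its tangent at `D` for `μ_a` and at `c` for
the rest gives the first inequality, with slack `(e^D - e^c)(μ_a - D) ≥ 0`.

The second inequality is weaker than the first. By the matrix-tree theorem `t n` is the product of
the nonzero eigenvalues, and an AM-GM argument bounds it by `D c^N`, so the second exponent is at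
most `c`.

Hence equality in either bound forces `μ_a = D` and all remaining eigenvalues equal to `c`. The
former yields a vertex adjacent to all others; the spectral decomposition then makes all remaining
vertex pairs adjacent, or none: `K_n` or a star. Conversely, both spectra are computed directly. -/

namespace SimpleGraph

/-! ### Matrix-tree theorem: rooted trees as parent functions -/

variable {V : Type*}

/-- The graph whose edges join every vertex to its image under `f`. -/
def functionalGraph (f : V → V) : SimpleGraph V := fromRel fun i j => f i = j

theorem functionalGraph_adj {f : V → V} {i j : V} :
    (functionalGraph f).Adj i j ↔ i ≠ j ∧ (f i = j ∨ f j = i) := Iff.rfl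

theorem reachable_functionalGraph_iterate (f : V → V) (k : ℕ) (i : V) :
    (functionalGraph f).Reachable i (f^[k] i) := by
  induction k generalizing i with
  | zero => exact Reachable.refl i
  | succ k ih =>
    rw [Function.iterate_succ_apply]
    refine Reachable.trans ?_ (ih (f i))
    by_cases h : i = f i
    · rw [← h]
    · exact Adj.reachable (functionalGraph_adj.2 ⟨h, Or.inl rfl⟩)

/-- Iterating `f` connects every vertex to `r`, and all edges are among the `n - 1` pairs `s(i, f
i)` with `i ≠ r`. -/
theorem isTree_functionalGraph [Fintype V] {f : V → V} {r : V} (hr : f r = r)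
    (hf : ∀ i, ∃ k, f^[k] i = r) : (functionalGraph f).IsTree := by
  classical
  have hreach : ∀ i, (functionalGraph f).Reachable i r := fun i => by
    obtain ⟨k, hk⟩ := hf i
    exact hk ▸ reachable_functionalGraph_iterate f k i
  have hconn : (functionalGraph f).Connected :=
    { preconnected := fun i j => (hreach i).trans (hreach j).symm, nonempty := ⟨r⟩ }
  refine isTree_iff_connected_and_card.2 ⟨hconn,
    le_antisymm ?_ hconn.card_vert_le_card_edgeSet_add_one⟩
  have hsub : (functionalGraph f).edgeSet ⊆
      ((Finset.univ.erase r).image fun i => s(i, f i) : Finset (Sym2 V)) := by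
    intro e
    induction e with
    | h i j =>
      intro h
      obtain ⟨hne, h⟩ := functionalGraph_adj.1 h
      simp only [Finset.coe_image, Set.mem_image, Finset.mem_coe, Finset.mem_erase,
        Finset.mem_univ, and_true]
      rcases h with h | h
      · refine ⟨i, ?_, by rw [h]⟩
        rintro rfl
        exact hne (hr.symm.trans h)
      · refine ⟨j, ?_, by rw [h, Sym2.eq_swap]⟩
        rintro rfl
        exact hne (h.symm.trans hr)
  have h1 := Set.ncard_le_ncard hsub (Finset.finite_toSet _)
  rw [Set.ncard_coe_finset] at h1
  have h2 := h1.trans Finset.card_image_le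
  rw [Finset.card_erase_of_mem (Finset.mem_univ r), Finset.card_univ] at h2
  have h3 : 0 < Fintype.card V := Fintype.card_pos_iff.2 ⟨r⟩
  rw [Nat.card_coe_set_eq, Nat.card_eq_fintype_card]
  omega

/-- Induction on the number of steps to `r`. If `g` oriented the edge from `i` to `f i` the other
way, the induction hypothesis would give `f (f i) = g (f i) = i`, a 2-cycle that never reaches `r`.
-/
theorem functionalGraph_injective {f g : V → V} {r : V} (hfr : f r = r) (hgr : g r = r)
    (hf : ∀ i, ∃ k, f^[k] i = r)
    (h : functionalGraph f = functionalGraph g) : f = g := by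
  have key : ∀ k i, f^[k] i = r → f i = g i := by
    intro k
    induction k with
    | zero =>
      rintro i rfl
      exact hfr.trans hgr.symm
    | succ k ih =>
      intro i hi
      have hj := ih (f i) hi
      by_cases hir : f i = i
      · have hfix : i = r := by rw [← hi, Function.iterate_fixed hir]
        rw [hfix, hfr, hgr]
      have hadj : (functionalGraph g).Adj i (f i) :=
        h ▸ functionalGraph_adj.2 ⟨Ne.symm hir, Or.inl rfl⟩
      rcases (functionalGraph_adj.1 hadj).2 with h1 | h1
      · exact h1.symm
      · exfalso
        have h2 : f^[2] i = i := hj.trans h1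
        obtain ⟨k, hk⟩ := hf i
        have h3 : f^[2 * k] i = i := by
          rw [Function.iterate_mul]; exact Function.iterate_fixed h2 k
        have h4 : f^[2 * k] i = r := by
          rw [two_mul, Function.iterate_add_apply, hk, Function.iterate_fixed hfr]
        have h5 : i = r := h3.symm.trans h4
        exact hir (by rw [h5, hfr])
  funext i
  obtain ⟨k, hk⟩ := hf i
  exact key k i hk

theorem Connected.exists_adj_dist_succ_eq {T : SimpleGraph V} (hT : T.Connected) {i r : V}
    (hi : i ≠ r) : ∃ j, T.Adj i j ∧ T.dist j r + 1 = T.dist i r := by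
  obtain ⟨p, hp⟩ := hT.exists_walk_length_eq_dist i r
  cases p with
  | nil => exact absurd rfl hi
  | @cons _ j _ h q =>
    refine ⟨j, h, ?_⟩
    have h1 := dist_le q
    rw [Walk.length_cons] at hp
    have h2 := hT.dist_triangle (u := i) (v := j) (w := r)
    rw [dist_eq_one_iff_adj.2 h] at h2
    omega

/-- The parent of a vertex is a neighbour one step closer to `r`. The resulting graph is a connected
subgraph of `T`, hence `T` itself, trees being minimal connected graphs. -/
theorem IsTree.exists_functionalGraph_eq [Fintype V] {T : SimpleGraph V} (hT : T.IsTree) (r : V) :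
    ∃ f : V → V, f r = r ∧ (∀ i, i ≠ r → T.Adj i (f i)) ∧ (∀ i, ∃ k, f^[k] i = r) ∧
      functionalGraph f = T := by
  classical
  choose! p hp using fun i (hi : i ≠ r) => hT.connected.exists_adj_dist_succ_eq hi
  let f : V → V := fun i => if i = r then r else p i
  have hfr : f r = r := if_pos rfl
  have hfi : ∀ i, i ≠ r → f i = p i := fun i hi => if_neg hi
  have hadj : ∀ i, i ≠ r → T.Adj i (f i) := fun i hi => by rw [hfi i hi]; exact (hp i hi).1
  have hreach : ∀ d i, T.dist i r = d → ∃ k, f^[k] i = r := by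
    intro d
    induction d with
    | zero =>
      intro i hi
      exact ⟨0, (hT.connected.dist_eq_zero_iff).1 hi⟩
    | succ d ih =>
      intro i hi
      have hir : i ≠ r := by
        rintro rfl
        simp at hi
      obtain ⟨k, hk⟩ := ih (f i) (by have := (hp i hir).2; rw [hfi i hir]; omega)
      exact ⟨k + 1, hk⟩
  have hf := fun i => hreach _ i rfl
  refine ⟨f, hfr, hadj, hf, ?_⟩
  have hle : functionalGraph f ≤ T := by
    intro i j h
    obtain ⟨hne, h⟩ := functionalGraph_adj.1 h
    rcases h with h | h
    · have hi : i ≠ r := by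
        rintro rfl
        exact hne (hfr.symm.trans h)
      exact h ▸ hadj i hi
    · have hj : j ≠ r := by
        rintro rfl
        exact hne (h.symm.trans hfr)
      exact (h ▸ hadj j hj).symm
  exact le_antisymm hle ((isTree_iff_minimal_connected.1 hT).2
    (isTree_functionalGraph hfr hf).connected hle)

/-- The matrix whose rows are `e_r` and `e_i - e_{f i}` for `i ≠ r`. -/
def parentMatrix [DecidableEq V] (r : V) (f : V → V) : Matrix V V ℝ :=
  fun i => if i = r then Pi.single r 1 else Pi.single i 1 - Pi.single (f i) 1

theorem det_parentMatrix_of_forall_exists [Fintype V] [DecidableEq V] {f : V → V} {r : V}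
    (hf : ∀ i, ∃ k, f^[k] i = r) : (parentMatrix r f).det = 1 := by
  have hlt : ∀ i, i ≠ r → Nat.find (hf (f i)) < Nat.find (hf i) := by
    intro i hi
    have h := Nat.find_spec (hf i)
    rcases hk : Nat.find (hf i) with _ | k
    · rw [hk] at h
      exact absurd h hi
    · rw [hk] at h
      exact Nat.lt_succ_of_le (Nat.find_min' _ h)
  -- Parents have smaller depth; the reversed order makes the matrix upper block triangular, with
  -- identity diagonal blocks.
  let b : V → ℕᵒᵈ := fun i => OrderDual.toDual (Nat.find (hf i))
  have hM : (parentMatrix r f).BlockTriangular b := by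
    intro i j hij
    have hij : Nat.find (hf i) < Nat.find (hf j) := hij
    have hne : j ≠ i := by rintro rfl; exact lt_irrefl _ hij
    unfold parentMatrix
    split_ifs with hi
    · rw [Pi.single_eq_of_ne (hi ▸ hne)]
    · have : j ≠ f i := by
        rintro rfl
        exact lt_asymm hij (hlt i hi)
      rw [Pi.sub_apply, Pi.single_eq_of_ne hne, Pi.single_eq_of_ne this, sub_zero]
  rw [hM.det]
  refine Finset.prod_eq_one fun a _ => ?_
  suffices h : (parentMatrix r f).toSquareBlock b a = 1 by rw [h, Matrix.det_one]
  ext ⟨i, hi⟩ ⟨j, hj⟩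
  simp only [Matrix.toSquareBlock_def, Matrix.of_apply, parentMatrix, Matrix.one_apply,
    Subtype.mk.injEq]
  split_ifs with h1 h2 h2
  · subst h1 h2; simp
  · subst h1; rw [Pi.single_eq_of_ne (Ne.symm h2)]
  all_goals
    have hfi : j ≠ f i := by
      rintro rfl
      have := hlt i h1
      have h3 : Nat.find (hf i) = Nat.find (hf (f i)) := OrderDual.toDual_inj.1 (hi.trans hj.symm)
      omega
    rw [Pi.sub_apply, Pi.single_eq_of_ne hfi]
  · subst h2; simp
  · rw [Pi.single_eq_of_ne (Ne.symm h2), sub_zero]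

theorem det_parentMatrix_of_not_forall_exists [Fintype V] [DecidableEq V] {f : V → V} {r : V}
    (hfr : f r = r) (hf : ¬ ∀ i, ∃ k, f^[k] i = r) : (parentMatrix r f).det = 0 := by
  classical
  push Not at hf
  obtain ⟨i₀, hi₀⟩ := hf
  rw [← Matrix.exists_mulVec_eq_zero_iff]
  -- The indicator of the vertices that never reach `r` is constant along `f` and vanishes at `r`,
  -- so it lies in the kernel.
  refine ⟨fun i => if ∃ k, f^[k] i = r then 0 else 1, ?_, ?_⟩
  · intro h
    have := congrFun h i₀
    simp [hi₀] at this
  · funext i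
    by_cases hi : i = r
    · have : ∃ k, f^[k] r = r := ⟨0, rfl⟩
      simp only [Matrix.mulVec, parentMatrix, if_pos hi, single_dotProduct, if_pos this,
        Pi.zero_apply, mul_zero]
    · have : (∃ k, f^[k] (f i) = r) ↔ ∃ k, f^[k] i = r := by
        constructor
        · rintro ⟨k, hk⟩
          exact ⟨k + 1, hk⟩
        · rintro ⟨k, hk⟩
          refine ⟨k, ?_⟩
          rw [← Function.iterate_succ_apply, Function.iterate_succ_apply', hk, hfr]
      simp only [Matrix.mulVec, parentMatrix, if_neg hi, sub_dotProduct, single_dotProduct, this,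
        Pi.zero_apply, sub_self]

variable [Fintype V] [DecidableEq V] (G : SimpleGraph V) [DecidableRel G.Adj]

/-- The possible parents of a vertex in a spanning tree rooted at `r`; the root is its own parent. -/
def parentCandidates (r i : V) : Finset V := if i = r then {r} else G.neighborFinset i

theorem updateRow_lapMatrix_eq_sum (r : V) :
    (G.lapMatrix ℝ).updateRow r (Pi.single r 1) = fun i => ∑ j ∈ G.parentCandidates r i,
      (if i = r then Pi.single r 1 else Pi.single i 1 - Pi.single j 1 : V → ℝ) := by
  funext i
  by_cases hi : i = r
  · subst hi
    simp [parentCandidates]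
  · rw [Matrix.updateRow_ne hi]
    funext k
    simp only [parentCandidates, if_neg hi, Finset.sum_sub_distrib, Finset.sum_const,
      Pi.sub_apply, Finset.sum_apply, lapMatrix, degMatrix, Matrix.sub_apply, Matrix.diagonal_apply,
      adjMatrix_apply, card_neighborFinset_eq_degree, Pi.single_apply]
    simp [eq_comm]

/-- Row `i ≠ r` of the Laplacian is the sum of `e_i - e_j` over neighbours `j`. Multilinear
expansion of the determinant gives one term per choice of parents, equal to 1 when the choice is a
spanning tree rooted at `r` and to 0 otherwise. -/
theorem adjugate_lapMatrix_apply_self (r : V) :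
    (G.lapMatrix ℝ).adjugate r r = G.numSpanningTrees := by
  classical
  rw [Matrix.adjugate_apply, updateRow_lapMatrix_eq_sum]
  have hexp := (Matrix.detRowAlternating (n := V) (R := ℝ)).toMultilinearMap.map_sum_finset
    (fun i j => (if i = r then Pi.single r 1 else Pi.single i 1 - Pi.single j 1 : V → ℝ))
    (G.parentCandidates r)
  refine hexp.trans ?_
  have hdet : ∀ f ∈ Fintype.piFinset (G.parentCandidates r),
      (parentMatrix r f).det = if ∀ i, ∃ k, f^[k] i = r then 1 else 0 := by
    intro f hf
    have hfr : f r = r := by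
      simpa [parentCandidates] using Fintype.mem_piFinset.1 hf r
    split_ifs with h
    · exact det_parentMatrix_of_forall_exists h
    · exact det_parentMatrix_of_not_forall_exists hfr h
  refine (Finset.sum_congr rfl hdet).trans ?_
  rw [Finset.sum_boole, numSpanningTrees, Nat.card_eq_fintype_card, Fintype.card_subtype]
  congr 1
  have hmem : ∀ f, f ∈ Fintype.piFinset (G.parentCandidates r) ↔
      f r = r ∧ ∀ i, i ≠ r → G.Adj i (f i) := by
    intro f
    rw [Fintype.mem_piFinset]
    constructor
    · intro h
      refine ⟨by simpa [parentCandidates] using h r, fun i hi => ?_⟩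
      simpa [parentCandidates, hi] using h i
    · rintro ⟨h1, h2⟩ i
      by_cases hi : i = r
      · simp [parentCandidates, hi, h1]
      · simpa [parentCandidates, hi] using h2 i hi
  refine Finset.card_bij (fun f _ => functionalGraph f) ?_ ?_ ?_
  · intro f hf
    obtain ⟨hf, hr⟩ := Finset.mem_filter.1 hf
    obtain ⟨h1, h2⟩ := (hmem f).1 hf
    refine Finset.mem_filter.2 ⟨Finset.mem_univ _, ?_, isTree_functionalGraph h1 hr⟩
    intro i j h
    obtain ⟨hne, h⟩ := functionalGraph_adj.1 h
    rcases h with h | h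
    · have hi : i ≠ r := by
        rintro rfl
        exact hne (h1.symm.trans h)
      exact h ▸ h2 i hi
    · have hj : j ≠ r := by
        rintro rfl
        exact hne (h.symm.trans h1)
      exact (h ▸ h2 j hj).symm
  · intro f hf g hg h
    obtain ⟨hf, hr⟩ := Finset.mem_filter.1 hf
    obtain ⟨hg, _⟩ := Finset.mem_filter.1 hg
    exact functionalGraph_injective ((hmem f).1 hf).1 ((hmem g).1 hg).1 hr h
  · intro T hT
    obtain ⟨hle, hT⟩ := (Finset.mem_filter.1 hT).2
    obtain ⟨f, h1, h2, h3, h4⟩ := hT.exists_functionalGraph_eq r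
    exact ⟨f, Finset.mem_filter.2 ⟨(hmem f).2 ⟨h1, fun i hi => hle (h2 i hi)⟩, h3⟩, h4⟩

end SimpleGraph

/-! ### Spectral expansions of real symmetric matrices -/

namespace Matrix.IsHermitian

variable {n : Type*} [Fintype n] [DecidableEq n] {A : Matrix n n ℝ} (hA : A.IsHermitian)

theorem sum_eigenvectorBasis_mul_eigenvectorBasis (i j : n) :
    ∑ k, hA.eigenvectorBasis i k * hA.eigenvectorBasis j k = if i = j then 1 else 0 := by
  have h := congrFun₂ (Unitary.coe_star_mul_self hA.eigenvectorUnitary) i j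
  simpa [Matrix.mul_apply, Matrix.one_apply] using h

theorem sum_eigenvectorBasis_apply_mul_apply (k l : n) :
    ∑ i, hA.eigenvectorBasis i k * hA.eigenvectorBasis i l = if k = l then 1 else 0 := by
  have h := congrFun₂ (Unitary.coe_mul_star_self hA.eigenvectorUnitary) k l
  simpa [Matrix.mul_apply, Matrix.one_apply] using h

theorem apply_eq_sum_eigenvalues (k l : n) :
    A k l = ∑ i, hA.eigenvalues i * hA.eigenvectorBasis i k * hA.eigenvectorBasis i l := by
  have h := congrFun₂ hA.spectral_theorem k l
  rw [Unitary.conjStarAlgAut_apply] at h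
  rw [h, Matrix.mul_apply]
  refine Finset.sum_congr rfl fun i _ => ?_
  simp [mul_comm]

theorem sum_mul_sum_eigenvectorBasis (w x : n → ℝ) :
    ∑ k, x k * ∑ l, (∑ i, w i * hA.eigenvectorBasis i k * hA.eigenvectorBasis i l) * x l =
      ∑ i, w i * (hA.eigenvectorBasis i ⬝ᵥ x) ^ 2 := by
  have h : ∀ k, x k * ∑ l, (∑ i, w i * hA.eigenvectorBasis i k * hA.eigenvectorBasis i l) * x l =
      ∑ i, w i * (hA.eigenvectorBasis i k * x k * (hA.eigenvectorBasis i ⬝ᵥ x)) := by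
    intro k
    simp only [dotProduct, Finset.sum_mul, Finset.mul_sum]
    rw [Finset.sum_comm]
    exact Finset.sum_congr rfl fun i _ => Finset.sum_congr rfl fun l _ => by ring
  rw [Finset.sum_congr rfl fun k _ => h k, Finset.sum_comm]
  refine Finset.sum_congr rfl fun i _ => ?_
  rw [← Finset.mul_sum, ← Finset.sum_mul, sq]
  rfl

theorem dotProduct_mulVec_eq_sum_eigenvalues (x : n → ℝ) :
    x ⬝ᵥ (A *ᵥ x) = ∑ i, hA.eigenvalues i * (hA.eigenvectorBasis i ⬝ᵥ x) ^ 2 := by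
  rw [← hA.sum_mul_sum_eigenvectorBasis]
  simp only [dotProduct, mulVec, hA.apply_eq_sum_eigenvalues]

theorem dotProduct_self_eq_sum (x : n → ℝ) :
    x ⬝ᵥ x = ∑ i, (hA.eigenvectorBasis i ⬝ᵥ x) ^ 2 := by
  have h := hA.sum_mul_sum_eigenvectorBasis 1 x
  simp only [Pi.one_apply, one_mul, hA.sum_eigenvectorBasis_apply_mul_apply, ite_mul, zero_mul,
    Finset.sum_ite_eq, Finset.mem_univ, if_true] at h
  exact h

theorem exists_le_eigenvalues {c : ℝ} {x : n → ℝ} (hx : x ≠ 0)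
    (h : c * (x ⬝ᵥ x) ≤ x ⬝ᵥ (A *ᵥ x)) : ∃ i, c ≤ hA.eigenvalues i := by
  by_contra! hc
  refine hx (dotProduct_self_eq_zero.1 ?_)
  rw [hA.dotProduct_mulVec_eq_sum_eigenvalues, hA.dotProduct_self_eq_sum, Finset.mul_sum] at h
  rw [hA.dotProduct_self_eq_sum]
  have hle : ∀ i ∈ Finset.univ, hA.eigenvalues i * (hA.eigenvectorBasis i ⬝ᵥ x) ^ 2 ≤
      c * (hA.eigenvectorBasis i ⬝ᵥ x) ^ 2 := fun i _ =>
    mul_le_mul_of_nonneg_right (hc i).le (sq_nonneg _)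
  have heq := (Finset.sum_eq_sum_iff_of_le hle).1 (le_antisymm (Finset.sum_le_sum hle) h)
  refine Finset.sum_eq_zero fun i hi => ?_
  by_contra h0
  exact (hc i).ne (mul_right_cancel₀ h0 (heq i hi))

theorem exists_lt_eigenvalues {c : ℝ} {x : n → ℝ}
    (h : c * (x ⬝ᵥ x) < x ⬝ᵥ (A *ᵥ x)) : ∃ i, c < hA.eigenvalues i := by
  by_contra! hc
  rw [hA.dotProduct_mulVec_eq_sum_eigenvalues, hA.dotProduct_self_eq_sum, Finset.mul_sum] at h
  exact absurd h (not_lt.2 (Finset.sum_le_sum fun i _ =>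
    mul_le_mul_of_nonneg_right (hc i) (sq_nonneg _)))

theorem trace_adjugate : A.adjugate.trace =
    ∑ i, ∏ j ∈ Finset.univ.erase i, hA.eigenvalues j := by
  have h := hA.spectral_theorem
  rw [Unitary.conjStarAlgAut_apply] at h
  conv_lhs => rw [h]
  rw [adjugate_mul_distrib, adjugate_mul_distrib, ← mul_assoc, trace_mul_comm, ← mul_assoc,
    ← adjugate_mul_distrib, Unitary.coe_star_mul_self, adjugate_one, one_mul, adjugate_diagonal,
    trace_diagonal]
  rfl

end Matrix.IsHermitian

/-! ### Laplacian eigenvalues of a connected graph -/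

namespace SimpleGraph

variable {V : Type*} [Fintype V] [DecidableEq V] (G : SimpleGraph V) [DecidableRel G.Adj]

theorem lapMatrix_mulVec_apply_eq_sum_sub (x : V → ℝ) (v : V) :
    (G.lapMatrix ℝ).mulVec x v = ∑ u ∈ G.neighborFinset v, (x v - x u) := by
  rw [lapMatrix_mulVec_apply, Finset.sum_sub_distrib, Finset.sum_const,
    card_neighborFinset_eq_degree, nsmul_eq_mul]

/-- The eigenvalues of the Laplacian matrix. -/
noncomputable abbrev lapEigenvalues : V → ℝ := (isHermitian_lapMatrix ℝ G).eigenvalues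

/-- An orthonormal basis of eigenvectors of the Laplacian matrix. -/
noncomputable abbrev lapEigenvectors (i : V) : V → ℝ :=
  (isHermitian_lapMatrix ℝ G).eigenvectorBasis i

theorem sum_neighborFinset_lapEigenvectors_sub (i v : V) :
    ∑ u ∈ G.neighborFinset v, (G.lapEigenvectors i v - G.lapEigenvectors i u) =
      G.lapEigenvalues i * G.lapEigenvectors i v := by
  rw [← lapMatrix_mulVec_apply_eq_sum_sub]
  exact congrFun ((isHermitian_lapMatrix ℝ G).mulVec_eigenvectorBasis i) v

theorem exists_lapEigenvectors_ne_zero (i : V) : ∃ v, G.lapEigenvectors i v ≠ 0 := by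
  by_contra! h
  have := (isHermitian_lapMatrix ℝ G).sum_eigenvectorBasis_mul_eigenvectorBasis i i
  rw [if_pos rfl, Finset.sum_eq_zero fun k _ => mul_eq_zero_of_left (h k) _] at this
  exact zero_ne_one this

theorem lapEigenvalues_nonneg (i : V) : 0 ≤ G.lapEigenvalues i :=
  (posSemidef_lapMatrix ℝ G).eigenvalues_nonneg i

theorem sum_lapEigenvalues : ∑ i, G.lapEigenvalues i = ∑ v, (G.degree v : ℝ) := by
  have h := (isHermitian_lapMatrix ℝ G).trace_eq_sum_eigenvalues
  simp only [RCLike.ofReal_real_eq_id, id] at h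
  rw [← h, Matrix.trace]
  simp [lapMatrix, degMatrix]

variable {G}

theorem Connected.lapEigenvectors_const (hG : G.Connected) {i : V} (hi : G.lapEigenvalues i = 0)
    (v w : V) : G.lapEigenvectors i v = G.lapEigenvectors i w := by
  refine G.lapMatrix_mulVec_eq_zero_iff_forall_reachable.1 ?_ v w (hG v w)
  rw [(isHermitian_lapMatrix ℝ G).mulVec_eigenvectorBasis i]
  exact (congrArg (· • _) hi).trans (zero_smul _ _)

theorem Connected.exists_lapEigenvalues_eq_zero (hG : G.Connected) :
    ∃ z, G.lapEigenvalues z = 0 ∧ (∀ i, i ≠ z → 0 < G.lapEigenvalues i) ∧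
      (∀ v w, G.lapEigenvectors z v * G.lapEigenvectors z w = 1 / Fintype.card V) ∧
      ∀ i, i ≠ z → ∑ v, G.lapEigenvectors i v = 0 := by
  have hne := hG.nonempty
  have hdet := (isHermitian_lapMatrix ℝ G).det_eq_prod_eigenvalues
  rw [det_lapMatrix_eq_zero] at hdet
  obtain ⟨z, -, hz⟩ := Finset.prod_eq_zero_iff.1 hdet.symm
  have hz : G.lapEigenvalues z = 0 := hz
  have hconst := hG.lapEigenvectors_const hz
  have hsum : ∀ i, i ≠ z → ∑ v, G.lapEigenvectors i v = 0 := by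
    intro i hi
    obtain ⟨w, hw⟩ := G.exists_lapEigenvectors_ne_zero z
    have h := (isHermitian_lapMatrix ℝ G).sum_eigenvectorBasis_mul_eigenvectorBasis i z
    rw [if_neg hi] at h
    have h2 : (∑ v, G.lapEigenvectors i v) * G.lapEigenvectors z w = 0 := by
      rw [Finset.sum_mul, ← h]
      exact Finset.sum_congr rfl fun v _ => by rw [hconst w v]
    exact (mul_eq_zero.1 h2).resolve_right hw
  refine ⟨z, hz, fun i hi => ?_, fun v w => ?_, hsum⟩
  · refine lt_of_le_of_ne (G.lapEigenvalues_nonneg i) fun h0 => ?_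
    obtain ⟨w, hw⟩ := G.exists_lapEigenvectors_ne_zero i
    have h := hsum i hi
    rw [Finset.sum_congr rfl fun v _ => hG.lapEigenvectors_const h0.symm v w, Finset.sum_const,
      nsmul_eq_mul] at h
    refine (mul_ne_zero ?_ hw) h
    exact Nat.cast_ne_zero.2 (Finset.card_ne_zero.2 Finset.univ_nonempty)
  · have h := (isHermitian_lapMatrix ℝ G).sum_eigenvectorBasis_mul_eigenvectorBasis z z
    rw [if_pos rfl, Finset.sum_congr rfl fun k _ =>
      congrArg₂ (· * ·) (hconst k v) (hconst k w), Finset.sum_const, nsmul_eq_mul,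
      Finset.card_univ] at h
    exact eq_one_div_of_mul_eq_one_right h

/-- Kirchhoff's matrix-tree theorem in terms of the nonzero Laplacian eigenvalues. -/
theorem card_mul_numSpanningTrees {z : V} (hz : G.lapEigenvalues z = 0) :
    (G.numSpanningTrees : ℝ) * Fintype.card V = ∏ i ∈ Finset.univ.erase z, G.lapEigenvalues i := by
  have h := (isHermitian_lapMatrix ℝ G).trace_adjugate
  rw [Finset.sum_eq_single z, Matrix.trace] at h
  · rw [← h]
    simp only [Matrix.diag_apply, adjugate_lapMatrix_apply_self, Finset.sum_const, nsmul_eq_mul,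
      Finset.card_univ, mul_comm]
  · intro i _ hi
    exact Finset.prod_eq_zero (Finset.mem_erase.2 ⟨hi.symm, Finset.mem_univ z⟩) hz
  · exact fun h => absurd (Finset.mem_univ z) h

/-- Rayleigh quotient of the vector equal to `d` at a vertex `r` of maximum degree `d`, to `-1` on
its neighbours and to 0 elsewhere; the required inequality already holds coordinatewise. -/
theorem Connected.exists_maxDegree_add_one_le_lapEigenvalues (hG : G.Connected)
    (h2 : 2 ≤ Fintype.card V) :
    ∃ a, 1 + (G.maxDegree : ℝ) ≤ G.lapEigenvalues a ∧
      (G.lapEigenvalues a = 1 + G.maxDegree → ∃ r, ∀ v, r ≠ v → G.Adj r v) := by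
  have hne := hG.nonempty
  have hnt : Nontrivial V := Fintype.one_lt_card_iff_nontrivial.1 h2
  obtain ⟨r, hr⟩ := G.exists_maximal_degree_vertex
  rw [hr]
  set d : ℝ := (G.degree r : ℝ) with hd
  have hd0 : 0 < d := Nat.cast_pos.2 (hG.preconnected.degree_pos_of_nontrivial r)
  let x : V → ℝ := fun v => if v = r then d else if G.Adj r v then -1 else 0
  have hxr : x r = d := if_pos rfl
  have hx1 : ∀ v, G.Adj r v → x v = -1 := fun v hv => by
    simp only [x, if_neg hv.ne', if_pos hv]
  have hx0 : ∀ v, v ≠ r → ¬ G.Adj r v → x v = 0 := fun v hv hv' => by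
    simp only [x, if_neg hv, if_neg hv']
  have hx_ge : ∀ v, 0 ≤ 1 + x v := fun v => by
    simp only [x]; split_ifs <;> linarith
  have hlap : ∀ v, G.Adj r v → (G.lapMatrix ℝ).mulVec x v =
      -∑ u ∈ G.neighborFinset v, (1 + x u) := by
    intro v hv
    rw [lapMatrix_mulVec_apply_eq_sum_sub, ← Finset.sum_neg_distrib, hx1 v hv]
    exact Finset.sum_congr rfl fun u _ => by ring
  have hmem : ∀ v, G.Adj r v → r ∈ G.neighborFinset v := fun v hv =>
    (G.mem_neighborFinset v r).2 hv.symm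
  have hterm : ∀ v ∈ Finset.univ, (1 + d) * (x v * x v) ≤ x v * (G.lapMatrix ℝ).mulVec x v := by
    intro v _
    by_cases hvr : v = r
    · subst hvr
      have : (G.lapMatrix ℝ).mulVec x v = d * (d + 1) := by
        rw [lapMatrix_mulVec_apply_eq_sum_sub, Finset.sum_congr rfl fun u hu =>
          (by rw [hx1 u ((G.mem_neighborFinset v u).1 hu), hxr, sub_neg_eq_add] :
            x v - x u = d + 1), Finset.sum_const, nsmul_eq_mul, card_neighborFinset_eq_degree]
      rw [this, hxr]
      exact le_of_eq (by ring)
    by_cases hadj : G.Adj r v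
    · have h := Finset.single_le_sum (f := fun u => 1 + x u) (fun u _ => hx_ge u) (hmem v hadj)
      simp only [hxr] at h
      rw [hlap v hadj, hx1 v hadj]
      linarith
    · rw [hx0 v hvr hadj]
      simp
  by_cases hdom : ∀ v, r ≠ v → G.Adj r v
  · have hx : x ≠ 0 := fun h => hd0.ne' (hxr.symm.trans (congrFun h r))
    obtain ⟨a, ha⟩ := (isHermitian_lapMatrix ℝ G).exists_le_eigenvalues hx (c := 1 + d) (by
      rw [dotProduct, Finset.mul_sum]
      exact Finset.sum_le_sum hterm)
    exact ⟨a, ha, fun _ => ⟨r, hdom⟩⟩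
  -- If `r` is not dominating, some neighbour of `r` has a neighbour at distance two from `r`; this
  -- adds 1 to its coordinate and makes the inequality strict.
  · push Not at hdom
    obtain ⟨w, hrw, hw⟩ := hdom
    obtain ⟨p⟩ := hG r w
    obtain ⟨e, -, he1, he2⟩ := p.exists_boundary_dart {v | v = r ∨ G.Adj r v} (Or.inl rfl)
      (by rintro (h | h); exacts [hrw h.symm, hw h])
    simp only [Set.mem_ofPred_eq, not_or] at he1 he2
    have hadj : G.Adj r e.fst := he1.resolve_left fun h => he2.2 (h ▸ e.adj)
    obtain ⟨a, ha⟩ := (isHermitian_lapMatrix ℝ G).exists_lt_eigenvalues (x := x) (c := 1 + d) (by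
      rw [dotProduct, Finset.mul_sum]
      refine Finset.sum_lt_sum hterm ⟨e.fst, Finset.mem_univ _, ?_⟩
      have h : ∑ u ∈ {r, e.snd}, (1 + x u) ≤ ∑ u ∈ G.neighborFinset e.fst, (1 + x u) := by
        refine Finset.sum_le_sum_of_subset_of_nonneg ?_ fun u _ _ => hx_ge u
        intro u hu
        rcases Finset.mem_insert.1 hu with rfl | hu
        · exact hmem _ hadj
        · rw [Finset.mem_singleton.1 hu]
          exact (G.mem_neighborFinset _ _).2 e.adj
      rw [Finset.sum_pair (Ne.symm he2.1), hxr, hx0 _ he2.1 he2.2] at h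
      rw [hlap _ hadj, hx1 _ hadj]
      linarith)
    exact ⟨a, ha.le, fun h => absurd h ha.ne'⟩

end SimpleGraph

/-! ### Tangent-line inequalities for the exponential -/

theorem Real.exp_mul_one_add_sub_le (x c : ℝ) : exp c * (1 + x - c) ≤ exp x := by
  have h := mul_le_mul_of_nonneg_left (Real.add_one_le_exp (x - c)) (exp_pos c).le
  rw [← exp_add, add_sub_cancel] at h
  linarith

theorem Real.eq_of_exp_mul_one_add_sub_eq {x c : ℝ} (h : exp c * (1 + x - c) = exp x) : x = c := by
  by_contra hne
  have h1 := mul_lt_mul_of_pos_left (Real.add_one_lt_exp (sub_ne_zero.2 hne)) (exp_pos c)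
  rw [← exp_add, add_sub_cancel] at h1
  linarith

section
variable {ι : Type*} {s : Finset ι} {μ : ι → ℝ} {c D x : ℝ}

theorem exp_add_mul_exp_le (hc : c ≤ D) (hx : D ≤ x)
    (hsum : ∑ i ∈ s, μ i = s.card * c + D - x) :
    Real.exp D + s.card * Real.exp c ≤ Real.exp x + ∑ i ∈ s, Real.exp (μ i) := by
  have h1 := Real.exp_mul_one_add_sub_le x D
  have h2 := Finset.sum_le_sum fun i (_ : i ∈ s) => Real.exp_mul_one_add_sub_le (μ i) c
  rw [← Finset.mul_sum, Finset.sum_sub_distrib, Finset.sum_add_distrib, hsum] at h2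
  simp only [Finset.sum_const, nsmul_eq_mul, mul_one] at h2
  nlinarith [mul_nonneg (sub_nonneg.2 (Real.exp_le_exp.2 hc)) (sub_nonneg.2 hx)]

theorem eq_of_exp_add_mul_exp_eq (hc : c ≤ D) (hx : D ≤ x)
    (hsum : ∑ i ∈ s, μ i = s.card * c + D - x)
    (h : Real.exp x + ∑ i ∈ s, Real.exp (μ i) = Real.exp D + s.card * Real.exp c) :
    x = D ∧ ∀ i ∈ s, μ i = c := by
  have h1 := Real.exp_mul_one_add_sub_le x D
  have hle := fun i (_ : i ∈ s) => Real.exp_mul_one_add_sub_le (μ i) c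
  have h2 := Finset.sum_le_sum hle
  have hs : ∑ i ∈ s, Real.exp c * (1 + μ i - c) = Real.exp c * (s.card + D - x) := by
    rw [← Finset.mul_sum, Finset.sum_sub_distrib, Finset.sum_add_distrib, hsum]
    simp only [Finset.sum_const, nsmul_eq_mul, mul_one]
    ring
  have h3 := mul_nonneg (sub_nonneg.2 (Real.exp_le_exp.2 hc)) (sub_nonneg.2 hx)
  refine ⟨Real.eq_of_exp_mul_one_add_sub_eq (by nlinarith), fun i hi => ?_⟩
  exact Real.eq_of_exp_mul_one_add_sub_eq
    ((Finset.sum_eq_sum_iff_of_le hle).1 (le_antisymm h2 (by rw [hs]; nlinarith)) i hi)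

/-- Apply `y ≤ exp (y - 1)` to `x / D` and to each `μ i / c`; the exponents add up to `-(x - D)(D -
c) / (c D) ≤ 0`. -/
theorem mul_prod_le_mul_pow (hc : c ≤ D) (hx : D ≤ x) (hc0 : 0 < c) (hμ : ∀ i ∈ s, 0 ≤ μ i)
    (hsum : ∑ i ∈ s, μ i = s.card * c + D - x) :
    x * ∏ i ∈ s, μ i ≤ D * c ^ s.card := by
  have hD : 0 < D := hc0.trans_le hc
  have key : x / D * ∏ i ∈ s, μ i / c ≤ 1 := by
    have h1 : x / D ≤ Real.exp (x / D - 1) := by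
      have := Real.add_one_le_exp (x / D - 1); linarith
    have h2 : ∏ i ∈ s, μ i / c ≤ ∏ i ∈ s, Real.exp (μ i / c - 1) :=
      Finset.prod_le_prod (fun i hi => div_nonneg (hμ i hi) hc0.le) fun i _ => by
        have := Real.add_one_le_exp (μ i / c - 1); linarith
    refine (mul_le_mul h1 h2 (Finset.prod_nonneg fun i hi => div_nonneg (hμ i hi) hc0.le)
      (Real.exp_pos _).le).trans ?_
    rw [← Real.exp_sum, ← Real.exp_add, Real.exp_le_one_iff, Finset.sum_sub_distrib,
      ← Finset.sum_div, hsum]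
    simp only [Finset.sum_const, nsmul_eq_mul, mul_one]
    have h3 : x / D - 1 + ((s.card * c + D - x) / c - s.card) = -((x - D) * (D - c) / (c * D)) := by
      field_simp
      ring
    rw [h3, neg_nonpos]
    exact div_nonneg (mul_nonneg (sub_nonneg.2 hx) (sub_nonneg.2 hc)) (mul_pos hc0 hD).le
  rw [Finset.prod_div_distrib, Finset.prod_const, div_mul_div_comm,
    div_le_one (mul_pos hD (pow_pos hc0 _))] at key
  exact key

end

/-! ### Spectral characterization of complete graphs and stars -/

namespace SimpleGraph

variable {V : Type*} [Fintype V] [DecidableEq V] {G : SimpleGraph V} [DecidableRel G.Adj]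

theorem degree_eq_of_forall_adj {r : V} (hr : ∀ v, r ≠ v → G.Adj r v) :
    G.degree r + 1 = Fintype.card V := by
  have : G.neighborFinset r = Finset.univ.erase r := by
    ext v
    rw [mem_neighborFinset, Finset.mem_erase]
    exact ⟨fun h => ⟨h.ne', Finset.mem_univ v⟩, fun h => hr v h.1.symm⟩
  rw [← card_neighborFinset_eq_degree, this, Finset.card_erase_of_mem (Finset.mem_univ r),
    Finset.card_univ]
  have : 0 < Fintype.card V := Fintype.card_pos_iff.2 ⟨r⟩
  omega

theorem maxDegree_eq_of_forall_adj {r : V} (hr : ∀ v, r ≠ v → G.Adj r v) :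
    G.maxDegree + 1 = Fintype.card V := by
  have := degree_eq_of_forall_adj hr
  have h1 := G.degree_le_maxDegree r
  have : Nonempty V := ⟨r⟩
  have h2 := G.maxDegree_lt_card_verts
  omega

theorem sum_neighborFinset_sub_of_forall_adj {r : V} (hr : ∀ v, r ≠ v → G.Adj r v) (x : V → ℝ) :
    ∑ u ∈ G.neighborFinset r, (x r - x u) = Fintype.card V * x r - ∑ u, x u := by
  have : G.neighborFinset r = Finset.univ.erase r := by
    ext v
    rw [mem_neighborFinset, Finset.mem_erase]
    exact ⟨fun h => ⟨h.ne', Finset.mem_univ v⟩, fun h => hr v h.1.symm⟩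
  have h := Finset.sum_erase (Finset.univ : Finset V) (f := fun u => x r - x u) (a := r) (sub_self _)
  rw [this, h, Finset.sum_sub_distrib, Finset.sum_const, nsmul_eq_mul, Finset.card_univ]

/-- The Laplacian spectrum of a complete graph or of a star: apart from `0` and `1 + d₁`, all
eigenvalues coincide. -/
theorem exists_lapEigenvalues_eq_of_eq_top_or_starGraph (hG : G.Connected)
    (h3 : 3 ≤ Fintype.card V) {z : V} (hz : G.lapEigenvalues z = 0)
    (hsum : ∀ i, i ≠ z → ∑ v, G.lapEigenvectors i v = 0)
    (h : G = ⊤ ∨ ∃ r : V, G = starGraph r) :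
    ∃ a c, a ≠ z ∧ G.lapEigenvalues a = 1 + G.maxDegree ∧
      ∀ i, i ≠ z → i ≠ a → G.lapEigenvalues i = c := by
  obtain ⟨a, ha, -⟩ := hG.exists_maxDegree_add_one_le_lapEigenvalues (by omega)
  have haz : a ≠ z := by
    rintro rfl
    have : (0 : ℝ) ≤ G.maxDegree := Nat.cast_nonneg _
    linarith
  -- At a dominating vertex `r`, an eigenvector with zero sum satisfies `n x_r = μ x_r`.
  have hval : ∀ r i, i ≠ z → (∀ v, r ≠ v → G.Adj r v) → G.lapEigenvectors i r ≠ 0 →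
      G.lapEigenvalues i = 1 + G.maxDegree := by
    intro r i hi hr hne
    have h1 := G.sum_neighborFinset_lapEigenvectors_sub i r
    rw [sum_neighborFinset_sub_of_forall_adj hr, hsum i hi, sub_zero] at h1
    rw [← mul_right_cancel₀ hne h1, ← maxDegree_eq_of_forall_adj hr]
    push_cast
    ring
  rcases h with h | ⟨r, h⟩
  · have hadj : ∀ r v, r ≠ v → G.Adj r v := fun r v hv => by rw [h]; exact hv
    have hall : ∀ i, i ≠ z → G.lapEigenvalues i = 1 + G.maxDegree := by
      intro i hi
      obtain ⟨r, hr⟩ := G.exists_lapEigenvectors_ne_zero i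
      exact hval r i hi (hadj r) hr
    exact ⟨a, _, haz, hall a haz, fun i hi _ => hall i hi⟩
  · have hadj : ∀ v w, G.Adj v w ↔ v ≠ w ∧ (v = r ∨ w = r) := fun v w => by
      rw [h]; exact starGraph_adj
    have hr : ∀ v, r ≠ v → G.Adj r v := fun v hv => (hadj r v).2 ⟨hv, Or.inl rfl⟩
    have hleaf : ∀ v, v ≠ r → G.neighborFinset v = {r} := by
      intro v hv
      ext w
      rw [mem_neighborFinset, hadj, Finset.mem_singleton]
      exact ⟨fun h => h.2.resolve_left hv, fun h => ⟨h ▸ hv, Or.inr h⟩⟩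
    -- An eigenvector vanishing at the centre has eigenvalue 1, read off at a leaf. The trace then
    -- shows that `1 + d₁` occurs only once.
    have hdich : ∀ i, i ≠ z → G.lapEigenvalues i = 1 + G.maxDegree ∨ G.lapEigenvalues i = 1 := by
      intro i hi
      by_cases h0 : G.lapEigenvectors i r = 0
      · right
        obtain ⟨v, hv⟩ := G.exists_lapEigenvectors_ne_zero i
        have hvr : v ≠ r := by rintro rfl; exact hv h0
        have h1 := G.sum_neighborFinset_lapEigenvectors_sub i v
        rw [hleaf v hvr, Finset.sum_singleton, h0, sub_zero] at h1
        exact (mul_right_cancel₀ hv ((one_mul _).trans h1)).symm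
      · exact Or.inl (hval r i hi hr h0)
    have hn := maxDegree_eq_of_forall_adj hr
    have hdeg := degree_eq_of_forall_adj hr
    have hcard : 2 ≤ G.maxDegree := by omega
    have hcard' : (2 : ℝ) ≤ G.maxDegree := by exact_mod_cast hcard
    have hμa : G.lapEigenvalues a = 1 + G.maxDegree :=
      (hdich a haz).resolve_right fun h => by linarith
    refine ⟨a, 1, haz, hμa, ?_⟩
    have hge : ∀ i ∈ (Finset.univ.erase z).erase a, 0 ≤ G.lapEigenvalues i - 1 := by
      intro i hi
      rcases hdich i (Finset.ne_of_mem_erase (Finset.mem_of_mem_erase hi)) with h | h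
      · rw [h]; linarith
      · rw [h]; linarith
    have htot := G.sum_lapEigenvalues
    rw [← Finset.add_sum_erase _ (fun v => (G.degree v : ℝ)) (Finset.mem_univ r),
      Finset.sum_congr (s₁ := Finset.univ.erase r) rfl fun v hv =>
      (by rw [← card_neighborFinset_eq_degree, hleaf v (Finset.ne_of_mem_erase hv),
        Finset.card_singleton, Nat.cast_one] : (G.degree v : ℝ) = 1),
      ← Finset.add_sum_erase _ G.lapEigenvalues (Finset.mem_univ z), hz,
      ← Finset.add_sum_erase _ G.lapEigenvalues (Finset.mem_erase.2 ⟨haz, Finset.mem_univ a⟩),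
      hμa] at htot
    have hc1 : (((Finset.univ.erase r).card : ℕ) : ℝ) = G.maxDegree := by
      rw [Finset.card_erase_of_mem (Finset.mem_univ r), Finset.card_univ, ← hn]; simp
    have hc2 : ((((Finset.univ.erase z).erase a).card : ℕ) : ℝ) = G.maxDegree - 1 := by
      rw [Finset.card_erase_of_mem (Finset.mem_erase.2 ⟨haz, Finset.mem_univ a⟩),
        Finset.card_erase_of_mem (Finset.mem_univ z), Finset.card_univ, ← hn,
        Nat.cast_sub (by omega)]
      simp
    have hdr : (G.degree r : ℝ) = G.maxDegree := by
      exact_mod_cast (by omega : G.degree r = G.maxDegree)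
    have hzero : ∑ i ∈ (Finset.univ.erase z).erase a, (G.lapEigenvalues i - 1) = 0 := by
      rw [Finset.sum_sub_distrib, Finset.sum_const, nsmul_eq_mul, hc2]
      rw [Finset.sum_const, nsmul_eq_mul, hc1, hdr] at htot
      linarith
    intro i hiz hia
    have := (Finset.sum_eq_zero_iff_of_nonneg hge).1 hzero i
      (Finset.mem_erase.2 ⟨hia, Finset.mem_erase.2 ⟨hiz, Finset.mem_univ i⟩⟩)
    linarith

/-- Subtracting `c` times the identity leaves only the `z` and `a` spectral terms, so off-diagonal
entries are determined by the eigenvector of `a`. As row `r` is `-1` off the diagonal, that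
eigenvector is constant away from `r` (unless `c = n`, when its term drops out), so adjacency is all
or nothing there. -/
theorem eq_top_or_starGraph_of_lapEigenvalues_eq {r z a : V} {c : ℝ}
    (hr : ∀ v, r ≠ v → G.Adj r v) (hz : G.lapEigenvalues z = 0) (haz : a ≠ z)
    (hzv : ∀ v w, G.lapEigenvectors z v * G.lapEigenvectors z w = 1 / Fintype.card V)
    (ha : G.lapEigenvalues a = Fintype.card V)
    (hc : ∀ i, i ≠ z → i ≠ a → G.lapEigenvalues i = c) :
    G = ⊤ ∨ ∃ r : V, G = starGraph r := by
  set n : ℝ := (Fintype.card V : ℝ) with hn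
  have hentry : ∀ k l, k ≠ l → G.lapMatrix ℝ k l =
      (n - c) * (G.lapEigenvectors a k * G.lapEigenvectors a l) - c / n := by
    intro k l hkl
    have h1 := (isHermitian_lapMatrix ℝ G).sum_eigenvectorBasis_apply_mul_apply k l
    rw [if_neg hkl] at h1
    have h2 : ∑ i, (G.lapEigenvalues i - c) *
        (G.lapEigenvectors i k * G.lapEigenvectors i l) = G.lapMatrix ℝ k l := by
      rw [(isHermitian_lapMatrix ℝ G).apply_eq_sum_eigenvalues]
      have : c * ∑ i, G.lapEigenvectors i k * G.lapEigenvectors i l = 0 := by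
        rw [h1, mul_zero]
      rw [← sub_zero (∑ i, (isHermitian_lapMatrix ℝ G).eigenvalues i * _ * _), ← this,
        Finset.mul_sum, ← Finset.sum_sub_distrib]
      exact Finset.sum_congr rfl fun i _ => by ring
    rw [← h2, ← Finset.add_sum_erase _ _ (Finset.mem_univ z),
      ← Finset.add_sum_erase _ _ (Finset.mem_erase.2 ⟨haz, Finset.mem_univ a⟩), hz, ha, hzv,
      Finset.sum_eq_zero fun i hi => ?_]
    · ring
    · rw [hc i (Finset.ne_of_mem_erase (Finset.mem_of_mem_erase hi)) (Finset.ne_of_mem_erase hi),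
        sub_self, zero_mul]
  have hlap : ∀ k l, k ≠ l → G.lapMatrix ℝ k l = if G.Adj k l then -1 else 0 := by
    intro k l hkl
    simp only [lapMatrix, degMatrix, Matrix.sub_apply, Matrix.diagonal_apply_ne _ hkl,
      adjMatrix_apply]
    split_ifs <;> simp
  have hconst : ∃ b : ℝ, ∀ k l, k ≠ r → l ≠ r → k ≠ l → G.lapMatrix ℝ k l = b := by
    by_cases hnc : n - c = 0
    · exact ⟨-(c / n), fun k l _ _ hkl => by rw [hentry k l hkl, hnc, zero_mul, zero_sub]⟩
    · have hprod : ∀ k, k ≠ r → (n - c) * G.lapEigenvectors a r * G.lapEigenvectors a k =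
          c / n - 1 := by
        intro k hk
        have h1 := hentry r k hk.symm
        rw [hlap r k hk.symm, if_pos (hr k hk.symm)] at h1
        linarith
      by_cases hp : G.lapEigenvectors a r = 0
      · by_cases hex : ∃ k, k ≠ r
        · obtain ⟨k, hk⟩ := hex
          have h1 := hprod k hk
          rw [hp, mul_zero, zero_mul] at h1
          have hn0 : n ≠ 0 := by
            rw [hn]; exact Nat.cast_ne_zero.2 (Fintype.card_pos_iff.2 ⟨r⟩).ne'
          have : c / n = 1 := by linarith
          rw [div_eq_one_iff_eq hn0] at this
          exact absurd (by rw [this, sub_self]) hnc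
        · push Not at hex
          exact ⟨0, fun k _ hk _ _ => absurd (hex k) hk⟩
      · have hval : ∀ k, k ≠ r → G.lapEigenvectors a k =
            (c / n - 1) / ((n - c) * G.lapEigenvectors a r) := fun k hk =>
          eq_div_of_mul_eq (mul_ne_zero hnc hp) (by rw [← hprod k hk]; ring)
        exact ⟨_, fun k l hk hl hkl => by rw [hentry k l hkl, hval k hk, hval l hl]⟩
  obtain ⟨b, hb⟩ := hconst
  have hb' : ∀ k l, k ≠ r → l ≠ r → k ≠ l → (G.Adj k l ↔ b = -1) := by
    intro k l hk hl hkl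
    rw [← hb k l hk hl hkl, hlap k l hkl]
    split_ifs with h <;> simp [h]
  by_cases hb1 : b = -1
  · left
    ext k l
    rw [top_adj]
    refine ⟨fun h => h.ne, fun hkl => ?_⟩
    by_cases hk : k = r
    · exact hk ▸ hr l (hk ▸ hkl)
    by_cases hl : l = r
    · exact (hl ▸ hr k (hl ▸ hkl.symm)).symm
    exact (hb' k l hk hl hkl).2 hb1
  · refine Or.inr ⟨r, ?_⟩
    ext k l
    rw [starGraph_adj]
    constructor
    · intro h
      refine ⟨h.ne, ?_⟩
      by_contra! hkl
      exact hb1 ((hb' k l hkl.1 hkl.2 h.ne).1 h)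
    · rintro ⟨hkl, rfl | rfl⟩
      · exact hr l hkl
      · exact (hr k hkl.symm).symm

end SimpleGraph

/-! ### The two bounds and their equality cases -/

theorem mainTheorem9 {V : Type*} [Fintype V] [DecidableEq V]
    (G : SimpleGraph V) [DecidableRel G.Adj] (hG : G.Connected)
    (n m t d₁ : ℕ) (hn : n = Fintype.card V) (hn3 : 3 ≤ n)
    (hm : m = G.edgeFinset.card) (ht : t = G.numSpanningTrees) (hd₁ : d₁ = G.maxDegree) :
    (G.laplacianEstradaIndex ≥
        1 + Real.exp (1 + (d₁ : ℝ)) +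
          ((n : ℝ) - 2) * Real.exp ((2 * (m : ℝ) - 1 - (d₁ : ℝ)) / ((n : ℝ) - 2))) ∧
    (G.laplacianEstradaIndex =
        1 + Real.exp (1 + (d₁ : ℝ)) +
          ((n : ℝ) - 2) * Real.exp ((2 * (m : ℝ) - 1 - (d₁ : ℝ)) / ((n : ℝ) - 2)) ↔
      (G = ⊤ ∨ ∃ r : V, G = SimpleGraph.starGraph r)) ∧
    (G.laplacianEstradaIndex ≥
        1 + Real.exp (1 + (d₁ : ℝ)) +
          ((n : ℝ) - 2) *
            Real.exp (((t : ℝ) * (n : ℝ) / (1 + (d₁ : ℝ))) ^ (1 / ((n : ℝ) - 2)))) ∧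
    (G.laplacianEstradaIndex =
        1 + Real.exp (1 + (d₁ : ℝ)) +
          ((n : ℝ) - 2) *
            Real.exp (((t : ℝ) * (n : ℝ) / (1 + (d₁ : ℝ))) ^ (1 / ((n : ℝ) - 2))) ↔
      (G = ⊤ ∨ ∃ r : V, G = SimpleGraph.starGraph r)) := by
  subst hn ht hd₁
  have hne := hG.nonempty
  obtain ⟨z, hz, hpos, hzv, hsum⟩ := hG.exists_lapEigenvalues_eq_zero
  set D : ℝ := 1 + (G.maxDegree : ℝ) with hD
  have hD0 : 0 < D := by positivity
  set N : ℕ := Fintype.card V - 2 with hN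
  have hN0 : N ≠ 0 := by omega
  have hNcast : (Fintype.card V : ℝ) - 2 = N := by
    rw [hN, Nat.cast_sub (by omega)]; norm_num
  have hNpos : (0 : ℝ) < N := Nat.cast_pos.2 (Nat.pos_of_ne_zero hN0)
  rw [hNcast]
  set c : ℝ := (2 * (m : ℝ) - 1 - (G.maxDegree : ℝ)) / N with hcdef
  have hNc : N * c = 2 * m - D := by
    rw [hcdef, hD]; field_simp; ring
  have htr : ∑ i, G.lapEigenvalues i = 2 * m := by
    rw [G.sum_lapEigenvalues, hm]
    exact_mod_cast G.sum_degrees_eq_twice_card_edges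
  have hsplit : ∀ (a : V), a ≠ z → ∀ g : V → ℝ, ∑ i, g i =
      g z + (g a + ∑ i ∈ (Finset.univ.erase z).erase a, g i) := fun a haz g => by
    rw [Finset.add_sum_erase _ _ (Finset.mem_erase.2 ⟨haz, Finset.mem_univ a⟩),
      Finset.add_sum_erase _ _ (Finset.mem_univ z)]
  have hcard : ∀ a : V, a ≠ z → ((Finset.univ.erase z).erase a).card = N := fun a haz => by
    rw [Finset.card_erase_of_mem (Finset.mem_erase.2 ⟨haz, Finset.mem_univ a⟩),
      Finset.card_erase_of_mem (Finset.mem_univ z), Finset.card_univ, Nat.sub_sub]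
  have hLEE : ∀ a : V, a ≠ z → G.laplacianEstradaIndex = 1 + (Real.exp (G.lapEigenvalues a) +
      ∑ i ∈ (Finset.univ.erase z).erase a, Real.exp (G.lapEigenvalues i)) := fun a haz => by
    rw [SimpleGraph.laplacianEstradaIndex,
      hsplit a haz fun i => Real.exp (G.lapEigenvalues i), hz, Real.exp_zero]
  have hprod : ∀ a : V, a ≠ z → (G.numSpanningTrees : ℝ) * Fintype.card V =
      G.lapEigenvalues a * ∏ i ∈ (Finset.univ.erase z).erase a, G.lapEigenvalues i :=
    fun a haz => by
      rw [SimpleGraph.card_mul_numSpanningTrees hz,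
        Finset.mul_prod_erase _ _ (Finset.mem_erase.2 ⟨haz, Finset.mem_univ a⟩)]
  have hsums : ∀ a : V, a ≠ z → ∑ i ∈ (Finset.univ.erase z).erase a, G.lapEigenvalues i =
      ((Finset.univ.erase z).erase a).card * c + D - G.lapEigenvalues a := fun a haz => by
    have := hsplit a haz G.lapEigenvalues
    rw [htr, hz] at this
    rw [hcard a haz, hNc]
    linarith
  obtain ⟨a, ha, hadom⟩ := hG.exists_maxDegree_add_one_le_lapEigenvalues (by omega)
  have haz : a ≠ z := by
    rintro rfl
    rw [hz] at ha
    exact absurd ha (not_le.2 hD0)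
  have hmem : ∀ i ∈ (Finset.univ.erase z).erase a, i ≠ z := fun i hi =>
    Finset.ne_of_mem_erase (Finset.mem_of_mem_erase hi)
  have hc0 : 0 < c := by
    have h1 : 0 < ∑ i ∈ (Finset.univ.erase z).erase a, G.lapEigenvalues i :=
      Finset.sum_pos (fun i hi => hpos i (hmem i hi))
        (Finset.card_pos.1 (by rw [hcard a haz]; omega))
    rw [hsums a haz, hcard a haz] at h1
    exact pos_of_mul_pos_right (by linarith : 0 < (N : ℝ) * c) hNpos.le
  -- From `2m ≤ n d₁` and `d₁ ≤ N + 1`: `N c = 2m - D ≤ (N + 1) d₁ - 1 ≤ N D`.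
  have hcD : c ≤ D := by
    have h1 : 2 * m ≤ Fintype.card V * G.maxDegree := by
      rw [hm, ← G.sum_degrees_eq_twice_card_edges]
      exact (Finset.sum_le_card_nsmul _ _ _ fun v _ => G.degree_le_maxDegree v)
    have h1' : 2 * (m : ℝ) ≤ (N + 2) * G.maxDegree := by
      rw [← hNcast, sub_add_cancel]; exact_mod_cast h1
    have h2 : (G.maxDegree : ℝ) ≤ N + 1 := by
      have := G.maxDegree_lt_card_verts
      exact_mod_cast (by omega : G.maxDegree ≤ N + 1)
    refine le_of_mul_le_mul_left ?_ hNpos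
    rw [hNc, hD]
    linarith
  have hineq : 1 + Real.exp D + N * Real.exp c ≤ G.laplacianEstradaIndex := by
    have := exp_add_mul_exp_le hcD ha (hsums a haz)
    rw [hcard a haz] at this
    rw [hLEE a haz]
    linarith
  have hchar : G.laplacianEstradaIndex = 1 + Real.exp D + N * Real.exp c →
      (G = ⊤ ∨ ∃ r : V, G = SimpleGraph.starGraph r) := by
    intro h
    rw [hLEE a haz] at h
    obtain ⟨h1, h2⟩ := eq_of_exp_add_mul_exp_eq hcD ha (hsums a haz) (by
      rw [hcard a haz]; linarith)
    obtain ⟨r, hr⟩ := hadom h1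
    refine SimpleGraph.eq_top_or_starGraph_of_lapEigenvalues_eq hr hz haz hzv ?_
      fun i hiz hia => h2 i (Finset.mem_erase.2 ⟨hia, Finset.mem_erase.2 ⟨hiz, Finset.mem_univ i⟩⟩)
    rw [h1, ← SimpleGraph.maxDegree_eq_of_forall_adj hr]
    push_cast
    ring
  set q : ℝ := (G.numSpanningTrees * Fintype.card V / D) ^ (1 / (N : ℝ)) with hq
  have hqc : q ≤ c := by
    have h1 := mul_prod_le_mul_pow hcD ha hc0 (fun i hi => (hpos i (hmem i hi)).le) (hsums a haz)
    rw [← hprod a haz, hcard a haz, ← div_le_iff₀' hD0] at h1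
    rw [hq, one_div, Real.rpow_inv_le_iff_of_pos (by positivity) hc0.le hNpos, Real.rpow_natCast]
    exact h1
  have hRHS : 1 + Real.exp D + N * Real.exp q ≤ 1 + Real.exp D + N * Real.exp c := by
    gcongr
  have hconv : (G = ⊤ ∨ ∃ r : V, G = SimpleGraph.starGraph r) →
      G.laplacianEstradaIndex = 1 + Real.exp D + N * Real.exp c ∧ q = c := by
    intro h
    obtain ⟨b, c', hbz, hb, hc'⟩ :=
      SimpleGraph.exists_lapEigenvalues_eq_of_eq_top_or_starGraph hG hn3 hz hsum h
    have hall : ∀ i ∈ (Finset.univ.erase z).erase b, G.lapEigenvalues i = c' := fun i hi =>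
      hc' i (Finset.ne_of_mem_erase (Finset.mem_of_mem_erase hi)) (Finset.ne_of_mem_erase hi)
    have hcc : c' = c := by
      have h1 := hsums b hbz
      rw [Finset.sum_congr rfl hall, Finset.sum_const, nsmul_eq_mul, hcard b hbz, hb,
        add_sub_cancel_right] at h1
      exact mul_left_cancel₀ hNpos.ne' h1
    constructor
    · rw [hLEE b hbz, hb, Finset.sum_congr rfl fun i hi => by rw [hall i hi, hcc],
        Finset.sum_const, nsmul_eq_mul, hcard b hbz, add_assoc]
    · rw [hq, hprod b hbz, Finset.prod_congr rfl hall, Finset.prod_const, hcard b hbz, hb, hcc,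
        mul_div_cancel_left₀ _ hD0.ne', one_div, Real.pow_rpow_inv_natCast hc0.le hN0]
  refine ⟨hineq, ⟨hchar, fun h => (hconv h).1⟩, hRHS.trans hineq, fun h => ?_, fun h => ?_⟩
  -- Equality in the second bound squeezes the index onto the larger first bound.
  · exact hchar (le_antisymm (h ▸ hRHS) hineq)
  · obtain ⟨h1, h2⟩ := hconv h
    rw [h1, h2]
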